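/- Let $R$ be a commutative artinian ring and let $\Gamma$ be an Artin $R$-algebra, i.e. an (associative, unital) $R$-algebra that is finitely generated as an $R$-module. Let $\operatorname{mod}\Gamma$ be the category of finitely generated left $\Gamma$-modules, with the exact structure whose conflations are all short exact sequences. The dominant dimension of $\Gamma$ is the supremum in $\mathbb N\cup\{\infty\}$ of all $n$ such that in a minimal injective resolution $0\to\Gamma\to I^0\to I^1\to\cdots$ of the left module $\Gamma$ the modules $I^0,\dots,I^{n-1}$ are projective. An exact category $\mathcal E$ (in the sense of Quillen), with class of projective objects $\mathcal P$, is called a Morita–Tachikawa category if, writing ${}^\perp\mathcal P=\{X\in\mathcal E \mid \operatorname{Hom}_{\mathcal E}(X,P)=0 \text{ for all } P\in\mathcal P\}$ and $\operatorname{cogen}\mathcal P$ for the class of objects that admit an inflation into an object of $\mathcal P$, 1. $\mathcal E$ has enough projectives, i.e. every object is the target of a deflation from a projective object; 2. $({}^\perp\mathcal P,\operatorname{cogen}\mathcal P)$ is a torsion pair: $\operatorname{Hom}_{\mathcal E}(T,F)=0$ for all $T\in{}^\perp\mathcal P$ and $F\in\operatorname{cogen}\mathcal P$, and every $X\in\mathcal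 E$ fits into a conflation $T\rightarrowtail X\twoheadrightarrow F$ with $T\in{}^\perp\mathcal P$ and $F\in\operatorname{cogen}\mathcal P$; 3. every morphism $X\to T$ with $T\in{}^\perp\mathcal P$ is admissible (a deflation followed by an inflation) with image in ${}^\perp\mathcal P$; 4. $\operatorname{Ext}^1_{\mathcal E}(X,P)=0$ for all $X\in{}^\perp\mathcal P$ and $P\in\mathcal P$. Then $\Gamma$ has dominant dimension at least $2$ if and only if $\operatorname{mod}\Gamma$ is a Morita–Tachikawa category. -/

import Mathlib

open CategoryTheory CategoryTheory.Limits

universe w v u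

/-! ### Exact categories -/

section ExactCategories

variable {C : Type u} [Category.{v} C] [Preadditive C]

/-- With respect to a class `K` of short complexes, `i` is an inflation if it is the first
morphism of a member `X ⟶ Y ⟶ W` of `K`. -/
def IsInflationOf (K : ShortComplex C → Prop) {X Y : C} (i : X ⟶ Y) : Prop :=
  ∃ (W : C) (p : Y ⟶ W) (h : i ≫ p = 0), K (ShortComplex.mk i p h)

/-- With respect to a class `K` of short complexes, `p` is a deflation if it is the second
morphism of a member `W ⟶ Y ⟶ Z` of `K`. -/
def IsDeflationOf (K : ShortComplex C → Prop) {Y Z : C} (p : Y ⟶ Z) : Prop :=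
  ∃ (W : C) (i : W ⟶ Y) (h : i ≫ p = 0), K (ShortComplex.mk i p h)

variable (C) in
/-- An exact structure in the sense of Quillen on an additive category: a class of
kernel-cokernel pairs `X₁ ⟶ X₂ ⟶ X₃`, called conflations, closed under isomorphism and subject
to the usual axioms. -/
structure ExactStructure [HasFiniteBiproducts C] where
  /-- the class of conflations -/
  conflation : ShortComplex C → Prop
  conflation_of_iso : ∀ {S T : ShortComplex C}, (S ≅ T) → conflation S → conflation T
  isKernel : ∀ {S : ShortComplex C}, conflation S →
    Nonempty (IsLimit (KernelFork.ofι S.f S.zero))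
  isCokernel : ∀ {S : ShortComplex C}, conflation S →
    Nonempty (IsColimit (CokernelCofork.ofπ S.g S.zero))
  inflation_id : ∀ X : C, IsInflationOf conflation (𝟙 X)
  deflation_id : ∀ X : C, IsDeflationOf conflation (𝟙 X)
  inflation_comp : ∀ {X Y Z : C} (i : X ⟶ Y) (j : Y ⟶ Z),
    IsInflationOf conflation i → IsInflationOf conflation j → IsInflationOf conflation (i ≫ j)
  deflation_comp : ∀ {X Y Z : C} (p : X ⟶ Y) (q : Y ⟶ Z),
    IsDeflationOf conflation p → IsDeflationOf conflation q → IsDeflationOf conflation (p ≫ q)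
  /-- pushouts of inflations along arbitrary morphisms exist and are inflations -/
  inflation_pushout : ∀ {X Y X' : C} (i : X ⟶ Y) (f : X ⟶ X'), IsInflationOf conflation i →
    ∃ (Y' : C) (g : Y ⟶ Y') (i' : X' ⟶ Y'), IsPushout i f g i' ∧ IsInflationOf conflation i'
  /-- pullbacks of deflations along arbitrary morphisms exist and are deflations -/
  deflation_pullback : ∀ {Y Z Z' : C} (p : Y ⟶ Z) (f : Z' ⟶ Z), IsDeflationOf conflation p →
    ∃ (Y' : C) (g : Y' ⟶ Y) (p' : Y' ⟶ Z'), IsPullback g p' p f ∧ IsDeflationOf conflation p'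

namespace ExactStructure

variable [HasFiniteBiproducts C] (E : ExactStructure C)

/-- Inflations (admissible monomorphisms) of an exact category. -/
def Inflation {X Y : C} (i : X ⟶ Y) : Prop := IsInflationOf E.conflation i

/-- Deflations (admissible epimorphisms) of an exact category. -/
def Deflation {X Y : C} (p : X ⟶ Y) : Prop := IsDeflationOf E.conflation p

/-- The projective objects of an exact category: those with the lifting property against all
deflations. -/
def projectives : ObjectProperty C := fun P =>
  ∀ ⦃X Y : C⦄ (p : X ⟶ Y), E.Deflation p → ∀ f : P ⟶ Y, ∃ g : P ⟶ X, g ≫ p = f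

/-- Every object is the target of a deflation from a projective object. -/
def HasEnoughProjectives : Prop :=
  ∀ X : C, ∃ (P : C) (p : P ⟶ X), E.projectives P ∧ E.Deflation p

/-- `cogen 𝒳`: the objects that admit an inflation into an object of `𝒳`. -/
def cogen (𝒳 : ObjectProperty C) : ObjectProperty C := fun X =>
  ∃ (Y : C) (i : X ⟶ Y), 𝒳 Y ∧ E.Inflation i

/-- `(𝒯, ℱ)` is a torsion pair: there are no nonzero morphisms from `𝒯` to `ℱ`, and every
object `X` fits into a conflation `T ⟶ X ⟶ F` with `T` in `𝒯` and `F` in `ℱ`. -/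
def IsTorsionPair (𝒯 ℱ : ObjectProperty C) : Prop :=
  (∀ ⦃T F : C⦄, 𝒯 T → ℱ F → ∀ f : T ⟶ F, f = 0) ∧
    ∀ X : C, ∃ (T F : C) (i : T ⟶ X) (p : X ⟶ F) (h : i ≫ p = 0),
      𝒯 T ∧ ℱ F ∧ E.conflation (ShortComplex.mk i p h)

/-- Axiom A2 for a subcategory `𝒯`: every morphism `X ⟶ T` to an object of `𝒯` is admissible
(a deflation followed by an inflation) with image in `𝒯`. -/
def AxiomA2 (𝒯 : ObjectProperty C) : Prop :=
  ∀ ⦃X T : C⦄, 𝒯 T → ∀ f : X ⟶ T, ∃ (I : C) (p : X ⟶ I) (i : I ⟶ T),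
    E.Deflation p ∧ E.Inflation i ∧ p ≫ i = f ∧ 𝒯 I

/-- An extension of `A` by `B`: a conflation `B ⟶ mid ⟶ A`. -/
structure Extension (A B : C) where
  mid : C
  incl : B ⟶ mid
  proj : mid ⟶ A
  zero : incl ≫ proj = 0
  conflation : E.conflation (ShortComplex.mk incl proj zero)

/-- Two extensions are equivalent if there is an isomorphism between the middle terms that is
compatible with the identities on both ends. -/
def extensionSetoid (A B : C) : Setoid (E.Extension A B) where
  r s t := ∃ e : s.mid ≅ t.mid, s.incl ≫ e.hom = t.incl ∧ e.hom ≫ t.proj = s.proj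
  iseqv :=
    { refl := fun s => ⟨Iso.refl _, by simp, by simp⟩
      symm := by
        rintro s t ⟨e, h₁, h₂⟩
        exact ⟨e.symm, by simp [← h₁], by simp [← h₂]⟩
      trans := by
        rintro s t r ⟨e, h₁, h₂⟩ ⟨e', h₁', h₂'⟩
        exact ⟨e ≪≫ e', by simp [reassoc_of% h₁, h₁'], by simp [h₂', h₂]⟩ }

/-- The first Yoneda extension group `Ext¹(A, B)` of an exact category (as a set): the
equivalence classes of conflations `B ⟶ mid ⟶ A`. Since split sequences are conflations, this set
is never empty; so `Ext¹(A, B) = 0` means that it has at most one element. -/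
def Ext1 (A B : C) : Type (max u v) := Quotient (E.extensionSetoid A B)

/-- An exact category is a Morita-Tachikawa category if, with `𝒫` its class of projective objects
and `⊥𝒫 = {X | Hom(X, P) = 0 for all P in 𝒫}`, it has enough projectives, `(⊥𝒫, cogen 𝒫)` is a
torsion pair, `⊥𝒫` satisfies axiom A2, and `Ext¹(⊥𝒫, 𝒫) = 0`. -/
structure IsMoritaTachikawa : Prop where
  enough_projectives : E.HasEnoughProjectives
  torsion_pair : E.IsTorsionPair E.projectives.leftOrthogonal (E.cogen E.projectives)
  axiomA2 : E.AxiomA2 E.projectives.leftOrthogonal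
  ext_vanishing : ∀ ⦃X P : C⦄, E.projectives.leftOrthogonal X → E.projectives P →
    Subsingleton (E.Ext1 X P)

end ExactStructure

end ExactCategories

/-! ### The standard exact structure of an abelian category -/

section AbelianCategories

attribute [local instance] Abelian.hasFiniteBiproducts

variable {C : Type u} [Category.{v} C] [Abelian C]

theorem isInflationOf_shortExact_iff {X Y : C} (i : X ⟶ Y) :
    IsInflationOf (fun S : ShortComplex C => S.ShortExact) i ↔ Mono i := by
  constructor
  · rintro ⟨W, p, h, hS⟩
    exact hS.mono_f
  · intro hi
    exact ⟨cokernel i, cokernel.π i, cokernel.condition i,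
      ShortComplex.ShortExact.mk' (ShortComplex.exact_cokernel i) hi inferInstance⟩

theorem isDeflationOf_shortExact_iff {X Y : C} (p : X ⟶ Y) :
    IsDeflationOf (fun S : ShortComplex C => S.ShortExact) p ↔ Epi p := by
  constructor
  · rintro ⟨W, i, h, hS⟩
    exact hS.epi_g
  · intro hp
    exact ⟨kernel p, kernel.ι p, kernel.condition p,
      ShortComplex.ShortExact.mk' (ShortComplex.exact_kernel p) inferInstance hp⟩

variable (C) in
/-- The standard exact structure of an abelian category: the conflations are all the short exact
sequences. -/
def ExactStructure.ofAbelian : ExactStructure C where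
  conflation S := S.ShortExact
  conflation_of_iso e h := ShortComplex.shortExact_of_iso e h
  isKernel h := ⟨h.fIsKernel⟩
  isCokernel h := ⟨h.gIsCokernel⟩
  inflation_id X := (isInflationOf_shortExact_iff _).2 inferInstance
  deflation_id X := (isDeflationOf_shortExact_iff _).2 inferInstance
  inflation_comp i j hi hj := by
    rw [isInflationOf_shortExact_iff] at *
    exact mono_comp i j
  deflation_comp p q hp hq := by
    rw [isDeflationOf_shortExact_iff] at *
    exact epi_comp p q
  inflation_pushout i f hi := by
    rw [isInflationOf_shortExact_iff] at hi
    exact ⟨pushout i f, pushout.inl i f, pushout.inr i f, IsPushout.of_hasPushout i f,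
      (isInflationOf_shortExact_iff _).2 inferInstance⟩
  deflation_pullback p f hp := by
    rw [isDeflationOf_shortExact_iff] at hp
    exact ⟨pullback p f, pullback.fst p f, pullback.snd p f, IsPullback.of_hasPullback p f,
      (isDeflationOf_shortExact_iff _).2 inferInstance⟩

end AbelianCategories

/-! ### Finitely generated modules and the dominant dimension -/

instance FGModuleCat.hasFiniteBiproducts_of_isNoetherianRing (Γ : Type u) [Ring Γ]
    [IsNoetherianRing Γ] : HasFiniteBiproducts (FGModuleCat.{u} Γ) :=
  Abelian.hasFiniteBiproducts

/-- The category `mod Γ` of finitely generated (left) modules over a (left) noetherian ring,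
with the exact structure given by all short exact sequences. -/
noncomputable def modExactStructure (Γ : Type u) [Ring Γ] [IsNoetherianRing Γ] :
    ExactStructure (FGModuleCat.{u} Γ) :=
  ExactStructure.ofAbelian (FGModuleCat.{u} Γ)

/-- An injective resolution `0 ⟶ M ⟶ I⁰ ⟶ I¹ ⟶ ⋯` of a module is minimal if, for every `n`,
the kernel of `Iⁿ ⟶ Iⁿ⁺¹` is an essential submodule of `Iⁿ` (so that `Iⁿ` is an injective
envelope of that kernel). -/
def IsMinimalInjectiveResolution {Γ : Type u} [Ring Γ] {M : ModuleCat.{u} Γ}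
    (I : InjectiveResolution M) : Prop :=
  ∀ (n : ℕ) (N : Submodule Γ (I.cocomplex.X n)),
    N ⊓ LinearMap.ker (I.cocomplex.d n (n + 1)).hom = ⊥ → N = ⊥

/-- The dominant dimension of a ring `Γ`: the supremum in `ℕ∞` of all `n` such that the terms
`I⁰, …, Iⁿ⁻¹` of a minimal injective resolution of the regular left module `Γ` are projective. -/
noncomputable def dominantDimension (Γ : Type u) [Ring Γ] : ℕ∞ :=
  ⨆ (n : ℕ) (_ : ∃ I : InjectiveResolution (ModuleCat.of Γ Γ), IsMinimalInjectiveResolution I ∧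
    ∀ i < n, Module.Projective Γ (I.cocomplex.X i)), (n : ℕ∞)

/-! Call a module torsion if it has no nonzero linear forms; in `mod Γ` these are the objects of
`⊥𝒫`.

Let `0 → Γ → I → J` be exact with `I` projective-injective and `J` projective. A linear form on a
submodule of `X` extends to a map `X → I`, and `I` embeds in a free module, so the form vanishes
once all linear forms of `X` vanish on the submodule (`subsingleton_hom_of_forall_comp_eq_zero`).
This yields the torsion pair and A2. Along an extension with torsion quotient, a form extends to a
map into `I`; its composite to `J` factors through the quotient, hence is zero, so the map lands in
`Γ` and Ext vanishes (`exists_extension_linearForm`).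

Conversely, take the minimal injective resolution of `Γ`; its first two terms are finitely generated
by `IsEssentialSubmodule.finite`. The torsion pair maps `Iᵏ` to a projective with torsion kernel. If
`ker dᵏ` has no nonzero torsion submodule, then A2 and essentiality make this map injective, so it
splits and `Iᵏ` is projective. For `k = 0`, `ker d⁰ ≅ Γ`. For `k = 1`, a torsion submodule of `ker
d¹ ≅ I⁰/Γ` lifts to `I⁰` by Ext-vanishing, and is zero because `I⁰` is projective. -/

/-! ### Essential submodules and injective hulls -/

section Essential

variable {Γ : Type u} [Ring Γ] {M : Type v} [AddCommGroup M] [Module Γ M]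

/-- A submodule is essential if it meets every nonzero submodule nontrivially. -/
def IsEssentialSubmodule (S : Submodule Γ M) : Prop :=
  ∀ N : Submodule Γ M, N ⊓ S = ⊥ → N = ⊥

theorem isEssentialSubmodule_iff {S : Submodule Γ M} :
    IsEssentialSubmodule S ↔ ∀ x : M, x ≠ 0 → ∃ r : Γ, r • x ∈ S ∧ r • x ≠ 0 := by
  constructor
  · intro h x hx
    by_contra! hr
    refine hx (Submodule.span_singleton_eq_bot.1 (h (Submodule.span Γ {x}) ?_))
    rw [eq_bot_iff]
    rintro y ⟨hy, hyS⟩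
    obtain ⟨r, rfl⟩ := Submodule.mem_span_singleton.1 hy
    exact hr r hyS
  · intro h N hN
    rw [eq_bot_iff]
    intro x hx
    by_contra hx0
    obtain ⟨r, hr, hr0⟩ := h x hx0
    have : r • x ∈ N ⊓ S := ⟨N.smul_mem r hx, hr⟩
    rw [hN] at this
    exact hr0 this

theorem exists_maximal_of_directed_union {p : Submodule Γ M → Prop} {S : Submodule Γ M} (hS : p S)
    (h : ∀ c : Set (Submodule Γ M), c.Nonempty → DirectedOn (· ≤ ·) c → (∀ N ∈ c, p N) →
      p (sSup c)) :
    ∃ E, S ≤ E ∧ Maximal p E :=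
  zorn_le_nonempty₀ {N | p N} (fun c hc hchain y hy =>
    ⟨sSup c, h c ⟨y, hy⟩ hchain.directedOn fun _ hN => hc hN, fun _ hz => le_sSup hz⟩) S hS

/-- Every submodule of an injective module `M` is an essential submodule of a direct summand of
`M`. -/
theorem exists_essential_retract [Module.Injective Γ M] (S : Submodule Γ M) :
    ∃ E : Submodule Γ M, ∃ _ : S ≤ E, (∀ x ∈ E, x ≠ 0 → ∃ r : Γ, r • x ∈ S ∧ r • x ≠ 0) ∧
      ∃ q : M →ₗ[Γ] E, ∀ x : E, q x = x := by
  -- `E` is a maximal essential extension of `S` inside `M`; below, `K` is a maximal submodule with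
  -- `E ∩ K = 0`.
  obtain ⟨E, hSE, hE, hEmax⟩ := exists_maximal_of_directed_union
    (p := fun E : Submodule Γ M => ∀ x ∈ E, x ≠ 0 → ∃ r : Γ, r • x ∈ S ∧ r • x ≠ 0) (S := S)
    (fun x hx hx0 => ⟨1, by simpa using hx, by simpa using hx0⟩)
    (fun c hne hdir hc x hx => by
      obtain ⟨N, hN, hxN⟩ := (Submodule.mem_sSup_of_directed hne hdir).1 hx
      exact hc N hN x hxN)
  obtain ⟨K, -, hK, hKmax⟩ := exists_maximal_of_directed_union
    (p := fun K : Submodule Γ M => ∀ x ∈ K, x ∈ E → x = 0) (S := ⊥)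
    (fun x hx _ => by simpa using hx)
    (fun c hne hdir hc x hx => by
      obtain ⟨N, hN, hxN⟩ := (Submodule.mem_sSup_of_directed hne hdir).1 hx
      exact hc N hN x hxN)
  have hj : Function.Injective (K.mkQ ∘ₗ E.subtype) := by
    rw [injective_iff_map_eq_zero]
    intro x hx
    exact Subtype.ext (hK x ((Submodule.Quotient.mk_eq_zero K).1 hx) x.2)
  -- the image of `E` is essential in `M ⧸ K`
  have hess : ∀ y : M ⧸ K, y ≠ 0 → ∃ r : Γ, ∃ e : E, r • y = K.mkQ e ∧ r • y ≠ 0 := by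
    intro y hy
    obtain ⟨y, rfl⟩ := K.mkQ_surjective y
    have hyK : y ∉ K := fun h => hy ((Submodule.Quotient.mk_eq_zero K).2 h)
    by_contra! hr
    refine hyK (hKmax (y := K ⊔ Submodule.span Γ {y}) ?_ le_sup_left
      (Submodule.mem_sup_right (Submodule.mem_span_singleton_self y)))
    intro x hx hxE
    obtain ⟨k, hk, z, hz, rfl⟩ := Submodule.mem_sup.1 hx
    obtain ⟨r, rfl⟩ := Submodule.mem_span_singleton.1 hz
    have hk0 : K.mkQ k = 0 := (Submodule.Quotient.mk_eq_zero K).2 hk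
    have h1 := hr r ⟨k + r • y, hxE⟩ (by rw [map_add, hk0, zero_add, map_smul])
    rw [← map_smul] at h1
    exact hK _ (K.add_mem hk ((Submodule.Quotient.mk_eq_zero K).1 h1)) hxE
  -- Since `E` embeds in `M ⧸ K`, injectivity of `M` extends the inclusion of `E` to `M ⧸ K`. The
  -- range of `φ` is again essential over `S`, so maximality of `E` turns `φ` into a retraction onto
  -- `E`.
  obtain ⟨φ, hφ⟩ := Module.Injective.out (K.mkQ ∘ₗ E.subtype) hj E.subtype
  replace hφ : ∀ e : E, φ (K.mkQ e) = e := hφ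
  have hφinj : ∀ y, φ y = 0 → y = 0 := by
    intro y hy
    by_contra hy0
    obtain ⟨r, e, he, hr0⟩ := hess y hy0
    apply hr0
    have : φ (r • y) = 0 := by rw [map_smul, hy, smul_zero]
    rw [he, hφ] at this
    rw [he, this, map_zero]
  have hrange : LinearMap.range φ ≤ E := by
    refine hEmax (y := LinearMap.range φ) ?_ ?_
    · rintro _ ⟨y, rfl⟩ hy
      obtain ⟨r, e, he, hr0⟩ := hess y (fun h => hy (by rw [h, map_zero]))
      have h1 : r • φ y = e := by rw [← map_smul, he, hφ]
      obtain ⟨s, hs, hs0⟩ := hE e e.2 (fun h => hr0 (by rw [he, h, map_zero]))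
      exact ⟨s * r, by rw [mul_smul, h1]; exact hs, by rw [mul_smul, h1]; exact hs0⟩
    · intro e he
      exact ⟨K.mkQ e, hφ ⟨e, he⟩⟩
  exact ⟨E, hSE, hE, (φ.codRestrict E fun y => hrange ⟨y, rfl⟩) ∘ₗ K.mkQ,
    fun x => Subtype.ext (hφ x)⟩

end Essential

/-- A direct summand of an injective module is injective. -/
theorem Module.Injective.of_retract {Γ : Type u} [Ring Γ] {M E : Type v} [AddCommGroup M]
    [Module Γ M] [AddCommGroup E] [Module Γ E] [Module.Injective Γ M] (i : E →ₗ[Γ] M)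
    (q : M →ₗ[Γ] E) (h : ∀ x, q (i x) = x) : Module.Injective Γ E := by
  refine ⟨fun {X Y} _ _ _ _ f hf g => ?_⟩
  obtain ⟨k, hk⟩ := Module.Injective.out f hf (i ∘ₗ g)
  exact ⟨q ∘ₗ k, fun x => by simp [hk, h]⟩

/-- Every module has an injective hull. -/
theorem ModuleCat.exists_injectiveHull {Γ : Type u} [Ring Γ] (M : ModuleCat.{u} Γ) :
    ∃ (E : ModuleCat.{u} Γ) (i : M ⟶ E), Injective E ∧ Mono i ∧
      IsEssentialSubmodule (LinearMap.range i.hom) := by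
  let J := Injective.under M
  let i : M ⟶ J := Injective.ι M
  have hi : Function.Injective i.hom := (ModuleCat.mono_iff_injective i).1 inferInstance
  have : Module.Injective Γ J := (Module.injective_iff_injective_object Γ J).2 (Injective.injective_under M)
  obtain ⟨E, hSE, hE, q, hq⟩ := exists_essential_retract (LinearMap.range i.hom)
  have : Module.Injective Γ E := Module.Injective.of_retract E.subtype q hq
  let k : M →ₗ[Γ] E := i.hom.codRestrict E fun x => hSE ⟨x, rfl⟩
  refine ⟨ModuleCat.of Γ E, ModuleCat.ofHom k,
    (Module.injective_iff_injective_object Γ E).1 inferInstance,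
    (ModuleCat.mono_iff_injective _).2 fun x y hxy => hi (congrArg Subtype.val hxy), ?_⟩
  rw [isEssentialSubmodule_iff]
  intro x hx
  obtain ⟨r, ⟨y, hy⟩, hr⟩ := hE x.1 x.2 (fun h => hx (Subtype.ext h))
  exact ⟨r, ⟨y, Subtype.ext hy⟩, fun h => hr (congrArg Subtype.val h)⟩

/-! ### Essential extensions over Artin algebras -/

section ArtinAlgebra

variable {R : Type w} [CommRing R] {Γ : Type u} [Ring Γ] [Algebra R Γ]

/-- Induction along a composition series. A map from a simple module to `I` has simple or zero
image, hence image in the essential `S`; evaluation at one nonzero element then embeds the Hom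
module in `S`. Left exactness of Hom gives the inductive step. -/
theorem isNoetherian_hom_of_isFiniteLength {I : Type v} [AddCommGroup I] [Module Γ I] [Module R I]
    [IsScalarTower R Γ I] {S : Submodule Γ I} [IsNoetherian R S] (hS : IsEssentialSubmodule S)
    {N : Type*} [AddCommGroup N] [Module Γ N] (hN : IsFiniteLength Γ N) :
    IsNoetherian R (N →ₗ[Γ] I) := by
  induction hN with
  | of_subsingleton => infer_instance
  | @of_simple_quotient N _ _ N' hsimple _ ih =>
    have : IsNoetherian R ((N ⧸ N') →ₗ[Γ] I) := by
      have := IsSimpleModule.nontrivial Γ (N ⧸ N')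
      obtain ⟨x, hx⟩ := exists_ne (0 : N ⧸ N')
      have hgen (f : (N ⧸ N') →ₗ[Γ] I) : f x ∈ S := by
        rcases eq_bot_or_eq_top (S.comap f) with h | h
        · have : LinearMap.range f = ⊥ := hS _ <| by
            rw [eq_bot_iff]
            rintro _ ⟨⟨y, rfl⟩, hy⟩
            have : y ∈ S.comap f := hy
            rw [h, Submodule.mem_bot] at this
            simp [this]
          rw [LinearMap.range_eq_bot] at this
          simp [this]
        · exact (h ▸ Submodule.mem_top : x ∈ S.comap f)
      let ev : ((N ⧸ N') →ₗ[Γ] I) →ₗ[R] S :=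
        { toFun f := ⟨f x, hgen f⟩
          map_add' f g := rfl
          map_smul' r f := rfl }
      refine isNoetherian_of_injective ev ?_
      rw [injective_iff_map_eq_zero]
      intro f hf
      have hfx : f x = 0 := congrArg Subtype.val hf
      rcases eq_bot_or_eq_top (LinearMap.ker f) with h | h
      · exact absurd (h ▸ LinearMap.mem_ker.2 hfx : x ∈ (⊥ : Submodule Γ (N ⧸ N'))) hx
      · exact LinearMap.ker_eq_top.1 h
    refine isNoetherian_of_range_eq_ker (LinearMap.lcomp R I N'.mkQ)
      (LinearMap.lcomp R I N'.subtype) ?_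
    ext f
    constructor
    · rintro ⟨g, rfl⟩
      ext x
      have : N'.mkQ x = 0 := (Submodule.Quotient.mk_eq_zero N').2 x.2
      change g (N'.mkQ x) = 0
      rw [this, map_zero]
    · intro hf
      have hker : N' ≤ LinearMap.ker f := fun x hx =>
        LinearMap.congr_fun (LinearMap.mem_ker.1 hf) ⟨x, hx⟩
      exact ⟨N'.liftQ f hker, N'.liftQ_mkQ f hker⟩

variable (R) in
/-- Over an Artin algebra, essential extensions of finitely generated modules are finitely
generated. -/
theorem IsEssentialSubmodule.finite [IsArtinianRing R] [Module.Finite R Γ] {I : Type v}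
    [AddCommGroup I] [Module Γ I] {S : Submodule Γ I} [Module.Finite Γ S]
    (hS : IsEssentialSubmodule S) : Module.Finite Γ I := by
  let _ : Module R I := Module.compHom I (algebraMap R Γ)
  have : IsScalarTower R Γ I := ⟨fun r x y => by
    rw [Algebra.smul_def, mul_smul]; rfl⟩
  have : IsNoetherianRing Γ := IsNoetherianRing.of_finite R Γ
  have : IsArtinianRing Γ := IsArtinianRing.of_finite R Γ
  have : Module.Finite R S := Module.Finite.trans Γ S
  -- The case `N = Γ` suffices, because `Hom(Γ, I) ≅ I`.
  have : IsNoetherian R (Γ →ₗ[Γ] I) := isNoetherian_hom_of_isFiniteLength hS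
    (isFiniteLength_iff_isNoetherian_isArtinian.2 ⟨inferInstance, inferInstance⟩)
  have : Module.Finite R I := Module.Finite.equiv (LinearMap.ringLmapEquivSelf Γ R I)
  exact Module.Finite.of_restrictScalars_finite R Γ I

end ArtinAlgebra

/-! ### Minimal injective resolutions -/

namespace ModuleCat

variable {Γ : Type u} [Ring Γ] (M : ModuleCat.{u} Γ)

/-- An injective hull of a module. -/
noncomputable def injectiveHull : ModuleCat.{u} Γ := M.exists_injectiveHull.choose

/-- The embedding of a module into its injective hull. -/
noncomputable def toInjectiveHull : M ⟶ M.injectiveHull :=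
  M.exists_injectiveHull.choose_spec.choose

instance injective_injectiveHull : Injective M.injectiveHull :=
  M.exists_injectiveHull.choose_spec.choose_spec.1

instance mono_toInjectiveHull : Mono M.toInjectiveHull :=
  M.exists_injectiveHull.choose_spec.choose_spec.2.1

theorem isEssentialSubmodule_range_toInjectiveHull :
    IsEssentialSubmodule (LinearMap.range M.toInjectiveHull.hom) :=
  M.exists_injectiveHull.choose_spec.choose_spec.2.2

/-- The iterated cosyzygies of a module. -/
noncomputable def cosyzygy : ℕ → ModuleCat.{u} Γ
  | 0 => M
  | n + 1 => cokernel (cosyzygy n).toInjectiveHull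

/-- The projection of the injective hull of a cosyzygy onto the next cosyzygy. -/
noncomputable def toCosyzygy (n : ℕ) : (M.cosyzygy n).injectiveHull ⟶ M.cosyzygy (n + 1) :=
  cokernel.π (M.cosyzygy n).toInjectiveHull

instance epi_toCosyzygy (n : ℕ) : Epi (M.toCosyzygy n) :=
  inferInstanceAs (Epi (cokernel.π (M.cosyzygy n).toInjectiveHull))

theorem toInjectiveHull_toCosyzygy (n : ℕ) :
    (M.cosyzygy n).toInjectiveHull ≫ M.toCosyzygy n = 0 :=
  cokernel.condition (M.cosyzygy n).toInjectiveHull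

theorem exact_toInjectiveHull_toCosyzygy (n : ℕ) :
    (ShortComplex.mk _ _ (M.toInjectiveHull_toCosyzygy n)).Exact :=
  ShortComplex.exact_cokernel (M.cosyzygy n).toInjectiveHull

/-- The differential of the minimal injective resolution. -/
noncomputable def minimalResolutionD (n : ℕ) :
    (M.cosyzygy n).injectiveHull ⟶ (M.cosyzygy (n + 1)).injectiveHull :=
  M.toCosyzygy n ≫ (M.cosyzygy (n + 1)).toInjectiveHull

theorem toInjectiveHull_comp_minimalResolutionD (n : ℕ) :
    (M.cosyzygy n).toInjectiveHull ≫ M.minimalResolutionD n = 0 := by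
  rw [minimalResolutionD, ← Category.assoc, toInjectiveHull_toCosyzygy, zero_comp]

theorem minimalResolutionD_comp (n : ℕ) :
    M.minimalResolutionD n ≫ M.minimalResolutionD (n + 1) = 0 := by
  rw [minimalResolutionD, Category.assoc, toInjectiveHull_comp_minimalResolutionD, comp_zero]

/-- Following the cokernel projection by a monomorphism does not change its kernel. -/
theorem exact_toInjectiveHull_minimalResolutionD (n : ℕ) :
    (ShortComplex.mk _ _ (M.toInjectiveHull_comp_minimalResolutionD n)).Exact := by
  let α : ShortComplex.mk _ _ (M.toInjectiveHull_toCosyzygy n) ⟶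
      ShortComplex.mk _ _ (M.toInjectiveHull_comp_minimalResolutionD n) :=
    { τ₁ := 𝟙 _
      τ₂ := 𝟙 _
      τ₃ := (M.cosyzygy (n + 1)).toInjectiveHull
      comm₁₂ := by simp
      comm₂₃ := by simp [minimalResolutionD] }
  have : Epi α.τ₁ := inferInstanceAs (Epi (𝟙 _))
  have : IsIso α.τ₂ := inferInstanceAs (IsIso (𝟙 _))
  have : Mono α.τ₃ := M.cosyzygy (n + 1) |>.mono_toInjectiveHull
  exact (ShortComplex.exact_iff_of_epi_of_isIso_of_mono α).1 (M.exact_toInjectiveHull_toCosyzygy n)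

theorem exact_minimalResolutionD (n : ℕ) :
    (ShortComplex.mk _ _ (M.minimalResolutionD_comp n)).Exact := by
  let α : ShortComplex.mk _ _ (M.minimalResolutionD_comp n) ⟶
      ShortComplex.mk _ _ (M.toInjectiveHull_comp_minimalResolutionD (n + 1)) :=
    { τ₁ := M.toCosyzygy n
      τ₂ := 𝟙 _
      τ₃ := 𝟙 _
      comm₁₂ := by simp [minimalResolutionD]
      comm₂₃ := by simp }
  have : Epi α.τ₁ := M.epi_toCosyzygy n
  have : IsIso α.τ₂ := inferInstanceAs (IsIso (𝟙 _))
  have : Mono α.τ₃ := inferInstanceAs (Mono (𝟙 _))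
  exact (ShortComplex.exact_iff_of_epi_of_isIso_of_mono α).2
    (M.exact_toInjectiveHull_minimalResolutionD (n + 1))

/-- The complex underlying the minimal injective resolution of a module. -/
noncomputable def minimalComplex : CochainComplex (ModuleCat.{u} Γ) ℕ :=
  CochainComplex.of (fun n => (M.cosyzygy n).injectiveHull) M.minimalResolutionD
    M.minimalResolutionD_comp

theorem minimalComplex_d (n : ℕ) : M.minimalComplex.d n (n + 1) = M.minimalResolutionD n :=
  CochainComplex.of_d (fun n => (M.cosyzygy n).injectiveHull) M.minimalResolutionD n

theorem minimalComplex_exactAt_succ (n : ℕ) : M.minimalComplex.ExactAt (n + 1) := by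
  rw [HomologicalComplex.exactAt_iff' _ n (n + 1) (n + 1 + 1) (by simp) (by simp)]
  have h := M.exact_minimalResolutionD n
  simp only [← minimalComplex_d] at h
  exact h

/-- The minimal injective resolution of a module. -/
noncomputable def minimalInjectiveResolution : InjectiveResolution M where
  cocomplex := M.minimalComplex
  injective n := (M.cosyzygy n).injective_injectiveHull
  ι := (CochainComplex.fromSingle₀Equiv _ _).symm ⟨M.toInjectiveHull, by
    rw [minimalComplex_d]; exact M.toInjectiveHull_comp_minimalResolutionD 0⟩
  quasiIso := ⟨fun n => by
    cases n
    · rw [CochainComplex.quasiIsoAt₀_iff, ShortComplex.quasiIso_iff_of_zeros]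
      · have h := M.exact_toInjectiveHull_minimalResolutionD 0
        refine (ShortComplex.exact_and_mono_f_iff_of_iso ?_).2
          ⟨h, M.mono_toInjectiveHull⟩
        refine ShortComplex.isoMk (Iso.refl _) (Iso.refl _) (Iso.refl _) ?_ ?_
        · simp
          rfl
        · simp [minimalComplex_d]
          exact (Category.id_comp _).trans (Category.comp_id _).symm
      all_goals rfl
    · rw [quasiIsoAt_iff_exactAt]
      · apply minimalComplex_exactAt_succ
      · apply CochainComplex.exactAt_succ_single_obj⟩

theorem isMinimal_minimalInjectiveResolution :
    IsMinimalInjectiveResolution M.minimalInjectiveResolution := by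
  intro n N hN
  have hd : M.minimalInjectiveResolution.cocomplex.d n (n + 1) = M.minimalResolutionD n :=
    M.minimalComplex_d n
  rw [hd] at hN
  have h := (M.exact_toInjectiveHull_minimalResolutionD n).moduleCat_range_eq_ker
  have h' : LinearMap.range (M.cosyzygy n).toInjectiveHull.hom =
      LinearMap.ker (M.minimalResolutionD n).hom := h
  exact (M.cosyzygy n).isEssentialSubmodule_range_toInjectiveHull N
    ((congrArg (fun K : Submodule Γ (M.cosyzygy n).injectiveHull => N ⊓ K) h').trans hN)

end ModuleCat

namespace CategoryTheory.InjectiveResolution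

variable {Γ : Type u} [Ring Γ] {M : ModuleCat.{u} Γ} (I : InjectiveResolution M)

theorem injective_module (n : ℕ) : Module.Injective Γ (I.cocomplex.X n) :=
  (Module.injective_iff_injective_object Γ (I.cocomplex.X n)).2 (I.injective n)

/-- The augmentation of an injective resolution of a module is the kernel of the first
differential. -/
theorem exists_augmentation : ∃ ι : M →ₗ[Γ] I.cocomplex.X 0, Function.Injective ι ∧
    LinearMap.range ι = LinearMap.ker (I.cocomplex.d 0 1).hom := by
  have hmono : Mono (I.ι.f 0) := inferInstance
  refine ⟨(I.ι.f 0).hom, (ModuleCat.mono_iff_injective _).1 hmono, ?_⟩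
  have h : (ShortComplex.mk _ _ I.ι_f_zero_comp_complex_d).Exact :=
    ShortComplex.exact_of_f_is_kernel _ I.isLimitKernelFork
  exact h.moduleCat_range_eq_ker

theorem range_d_eq_ker_d (n : ℕ) : LinearMap.range (I.cocomplex.d n (n + 1)).hom =
    LinearMap.ker (I.cocomplex.d (n + 1) (n + 2)).hom :=
  (I.exact_succ n).moduleCat_range_eq_ker

end CategoryTheory.InjectiveResolution

/-! ### Modules without nonzero maps to the ring -/

section Torsion

variable {Γ : Type u} [Ring Γ]

/-- A projective module embeds in a free one, and each coordinate of a map to a free module is a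
linear form. -/
theorem Module.Projective.subsingleton_hom {X P : Type*} [AddCommGroup X] [Module Γ X]
    [AddCommGroup P] [Module Γ P] [Module.Projective Γ P] (h : Subsingleton (X →ₗ[Γ] Γ)) :
    Subsingleton (X →ₗ[Γ] P) := by
  obtain ⟨s, hs⟩ := Module.projective_def'.1 (inferInstance : Module.Projective Γ P)
  refine subsingleton_of_forall_eq 0 fun f => LinearMap.ext fun x => ?_
  have : s (f x) = 0 := Finsupp.ext fun p =>
    LinearMap.congr_fun (Subsingleton.elim (Finsupp.lapply p ∘ₗ s ∘ₗ f) 0) x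
  rw [LinearMap.zero_apply, ← LinearMap.id_apply (R := Γ) (f x), ← hs, LinearMap.comp_apply, this,
    map_zero]

/-- If `Γ` embeds into a projective-injective module, then a submodule that is annihilated by all
linear forms of the ambient module has no nonzero linear forms. -/
theorem subsingleton_hom_of_forall_comp_eq_zero {I X N : Type u} [AddCommGroup I] [Module Γ I]
    [Module.Injective Γ I] [Module.Projective Γ I] [AddCommGroup X] [Module Γ X] [AddCommGroup N]
    [Module Γ N] (ι : Γ →ₗ[Γ] I) (hι : Function.Injective ι) (j : N →ₗ[Γ] X)
    (hj : Function.Injective j) (h : ∀ f : X →ₗ[Γ] Γ, f ∘ₗ j = 0) : Subsingleton (N →ₗ[Γ] Γ) := by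
  refine subsingleton_of_forall_eq 0 fun f => LinearMap.ext fun x => hι ?_
  -- The form itself need not extend to `X`, but its composite into `I` does; the coordinates of
  -- that extension in a free module are linear forms on `X`, to which `h` applies.
  obtain ⟨g, hg⟩ := Module.Injective.out j hj (ι ∘ₗ f)
  obtain ⟨s, hs⟩ := Module.projective_def'.1 (inferInstance : Module.Projective Γ I)
  have : s (g (j x)) = 0 := Finsupp.ext fun p =>
    LinearMap.congr_fun (h (Finsupp.lapply p ∘ₗ s ∘ₗ g)) x
  have h0 : g (j x) = 0 := by
    rw [← LinearMap.id_apply (R := Γ) (g (j x)), ← hs, LinearMap.comp_apply, this, map_zero]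
  rw [LinearMap.zero_apply, map_zero, ← h0, hg, LinearMap.comp_apply]

variable (Γ) in
/-- Over an artinian module, all linear forms factor modulo their common kernel through a single
map to a finitely generated projective module. -/
theorem exists_projective_forall_ker_le (X : Type u) [AddCommGroup X] [Module Γ X]
    [IsArtinian Γ X] : ∃ (P : Type u) (_ : AddCommGroup P) (_ : Module Γ P) (g : X →ₗ[Γ] P),
      Module.Finite Γ P ∧ Module.Projective Γ P ∧
        ∀ f : X →ₗ[Γ] Γ, LinearMap.ker g ≤ LinearMap.ker f := by
  obtain ⟨_, ⟨P, _, _, g, hP, hP', rfl⟩, hmin⟩ := IsArtinian.set_has_minimal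
    {N : Submodule Γ X | ∃ (P : Type u) (_ : AddCommGroup P) (_ : Module Γ P) (g : X →ₗ[Γ] P),
      Module.Finite Γ P ∧ Module.Projective Γ P ∧ LinearMap.ker g = N}
    ⟨_, Γ, inferInstance, inferInstance, 0, inferInstance, inferInstance, rfl⟩
  refine ⟨P, _, _, g, hP, hP', fun f => ?_⟩
  -- Adjoining `f` as a further coordinate cannot shrink a minimal kernel.
  have h := hmin _ ⟨P × Γ, inferInstance, inferInstance, g.prod f, inferInstance, inferInstance, rfl⟩
  rw [LinearMap.ker_prod] at h
  by_contra hf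
  exact h (lt_of_le_of_ne inf_le_left fun he => hf (inf_eq_left.1 he))

/-- If `0 ⟶ Γ ⟶ I ⟶ J` is exact with `I` injective and `J` projective, then linear forms extend
along extensions by modules without linear forms. -/
theorem exists_extension_linearForm {I J A E X : Type u} [AddCommGroup I] [Module Γ I]
    [Module.Injective Γ I] [AddCommGroup J] [Module Γ J] [Module.Projective Γ J]
    [AddCommGroup A] [Module Γ A] [AddCommGroup E] [Module Γ E] [AddCommGroup X] [Module Γ X]
    (ι : Γ →ₗ[Γ] I) (hι : Function.Injective ι) (d : I →ₗ[Γ] J)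
    (hd : LinearMap.range ι = LinearMap.ker d) (i : A →ₗ[Γ] E) (hi : Function.Injective i)
    (p : E →ₗ[Γ] X) (hp : Function.Surjective p) (hip : Function.Exact i p)
    (hX : Subsingleton (X →ₗ[Γ] Γ)) (f : A →ₗ[Γ] Γ) : ∃ g : E →ₗ[Γ] Γ, g ∘ₗ i = f := by
  obtain ⟨g, hg⟩ := Module.Injective.out i hi (ι ∘ₗ f)
  have hker : LinearMap.ker p ≤ LinearMap.ker (d ∘ₗ g) := by
    intro x hx
    obtain ⟨a, rfl⟩ := (hip x).1 hx
    have : ι (f a) ∈ LinearMap.ker d := hd ▸ LinearMap.mem_range_self ι (f a)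
    rw [LinearMap.mem_ker, LinearMap.comp_apply, hg]
    exact this
  -- `d ∘ g` kills `A`, so it descends to a map from the torsion module `X` to the projective `J`.
  have hdg (x : E) : d (g x) = 0 := by
    let q := (LinearMap.ker p).liftQ (d ∘ₗ g) hker ∘ₗ
      (p.quotKerEquivOfSurjective hp).symm.toLinearMap
    have hq : q = 0 := (Module.Projective.subsingleton_hom (P := J) hX).elim q 0
    have h := LinearMap.congr_fun hq (p x)
    have hpx : (p.quotKerEquivOfSurjective hp).symm (p x) = (LinearMap.ker p).mkQ x := by
      rw [LinearEquiv.symm_apply_eq]; rfl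
    simpa [q, hpx] using h
  let e := LinearEquiv.ofInjective ι hι
  refine ⟨e.symm.toLinearMap ∘ₗ g.codRestrict (LinearMap.range ι) fun x => hd ▸ hdg x,
    LinearMap.ext fun a => ?_⟩
  rw [LinearMap.comp_apply, LinearMap.comp_apply, LinearEquiv.coe_coe, LinearEquiv.symm_apply_eq]
  exact Subtype.ext (hg a)

/-- Suppose that the class of modules without nonzero linear forms is closed under submodules. If
an essential submodule of `I` contains no nonzero submodule of this class, then every map from `I`
whose kernel lies in this class is injective. -/
theorem injective_of_isEssentialSubmodule {I P : Type u} [AddCommGroup I] [Module Γ I]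
    [AddCommGroup P] [Module Γ P]
    (hered : ∀ (X : Type u) [AddCommGroup X] [Module Γ X] [Module.Finite Γ X],
      Subsingleton (X →ₗ[Γ] Γ) → ∀ N : Submodule Γ X, Subsingleton (N →ₗ[Γ] Γ))
    {K : Submodule Γ I} (hK : IsEssentialSubmodule K)
    (hKtors : ∀ N ≤ K, Subsingleton (N →ₗ[Γ] Γ) → N = ⊥) (g : I →ₗ[Γ] P)
    [Module.Finite Γ (LinearMap.ker g)] (hg : Subsingleton (LinearMap.ker g →ₗ[Γ] Γ)) :
    Function.Injective g := by
  rw [← LinearMap.ker_eq_bot]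
  refine hK _ (hKtors _ inf_le_right ?_)
  have h := hered (LinearMap.ker g) hg (K.comap (LinearMap.ker g).subtype)
  have e : (K.comap (LinearMap.ker g).subtype) ≃ₗ[Γ] (LinearMap.ker g ⊓ K : Submodule Γ I) :=
    (Submodule.equivMapOfInjective _ (LinearMap.ker g).subtype_injective _).trans
      (LinearEquiv.ofEq _ _ (Submodule.map_comap_subtype _ _))
  exact (e.congrLeft Γ ℕ).symm.toEquiv.subsingleton

theorem Module.Projective.of_injective_map {I P : Type u} [AddCommGroup I] [Module Γ I]
    [Module.Injective Γ I] [AddCommGroup P] [Module Γ P] [Module.Projective Γ P]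
    (g : I →ₗ[Γ] P) (hg : Function.Injective g) : Module.Projective Γ I := by
  obtain ⟨r, hr⟩ := Module.Injective.out g hg LinearMap.id
  exact Module.Projective.of_split g r (LinearMap.ext hr)

end Torsion

/-! ### Finitely generated modules -/

namespace FGModuleCat

variable {Γ : Type u} [Ring Γ] [IsNoetherianRing Γ]

theorem mono_iff_injective {X Y : FGModuleCat.{u} Γ} (f : X ⟶ Y) :
    Mono f ↔ Function.Injective f.hom.hom := by
  rw [← ModuleCat.mono_iff_injective]
  exact ((forget₂ (FGModuleCat Γ) (ModuleCat Γ)).mono_map_iff_mono f).symm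

theorem epi_iff_surjective {X Y : FGModuleCat.{u} Γ} (f : X ⟶ Y) :
    Epi f ↔ Function.Surjective f.hom.hom := by
  rw [← ModuleCat.epi_iff_surjective]
  exact ((forget₂ (FGModuleCat Γ) (ModuleCat Γ)).epi_map_iff_epi f).symm

theorem shortExact_iff (S : ShortComplex (FGModuleCat.{u} Γ)) :
    S.ShortExact ↔ Function.Injective S.f.hom.hom ∧ Function.Surjective S.g.hom.hom ∧
      Function.Exact S.f.hom.hom S.g.hom.hom := by
  have h : S.Exact ↔ Function.Exact S.f.hom.hom S.g.hom.hom := by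
    rw [← S.exact_map_iff_of_faithful (forget₂ (FGModuleCat Γ) (ModuleCat Γ)),
      ShortComplex.ShortExact.moduleCat_exact_iff_function_exact]
    rfl
  rw [← mono_iff_injective, ← epi_iff_surjective, ← h]
  exact ⟨fun hS => ⟨hS.mono_f, hS.epi_g, hS.exact⟩, fun ⟨h₁, h₂, h₃⟩ => ⟨h₃⟩⟩

end FGModuleCat

/-! ### The exact structure on finitely generated modules -/

section ModExactStructure

variable {Γ : Type u} [Ring Γ] [IsNoetherianRing Γ]

theorem modExactStructure_conflation_iff (S : ShortComplex (FGModuleCat.{u} Γ)) :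
    (modExactStructure Γ).conflation S ↔ Function.Injective S.f.hom.hom ∧
      Function.Surjective S.g.hom.hom ∧ Function.Exact S.f.hom.hom S.g.hom.hom :=
  FGModuleCat.shortExact_iff S

theorem modExactStructure_inflation_iff {X Y : FGModuleCat.{u} Γ} (i : X ⟶ Y) :
    (modExactStructure Γ).Inflation i ↔ Function.Injective i.hom.hom :=
  (isInflationOf_shortExact_iff i).trans (FGModuleCat.mono_iff_injective i)

theorem modExactStructure_deflation_iff {X Y : FGModuleCat.{u} Γ} (p : X ⟶ Y) :
    (modExactStructure Γ).Deflation p ↔ Function.Surjective p.hom.hom :=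
  (isDeflationOf_shortExact_iff p).trans (FGModuleCat.epi_iff_surjective p)

theorem exists_free_surjective (Γ : Type u) [Ring Γ] (X : FGModuleCat.{u} Γ) :
    ∃ (P : FGModuleCat.{u} Γ) (p : P ⟶ X), Module.Projective Γ P ∧
      Function.Surjective p.hom.hom := by
  obtain ⟨n, f, hf⟩ := Module.Finite.exists_fin' Γ X
  let e : (ULift.{u} (Fin n) → Γ) ≃ₗ[Γ] (Fin n → Γ) :=
    LinearEquiv.funCongrLeft Γ Γ Equiv.ulift.symm
  exact ⟨FGModuleCat.of Γ (ULift.{u} (Fin n) → Γ), FGModuleCat.ofHom (f ∘ₗ e.toLinearMap),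
    inferInstanceAs (Module.Projective Γ (ULift.{u} (Fin n) → Γ)), hf.comp e.surjective⟩

theorem modExactStructure_projectives_iff (P : FGModuleCat.{u} Γ) :
    (modExactStructure Γ).projectives P ↔ Module.Projective Γ P := by
  constructor
  · intro hP
    obtain ⟨Q, p, hQ, hp⟩ := exists_free_surjective Γ P
    obtain ⟨s, hs⟩ := hP p ((modExactStructure_deflation_iff p).2 hp) (𝟙 P)
    exact Module.Projective.of_split s.hom.hom p.hom.hom
      (congrArg (fun f : P ⟶ P => f.hom.hom) hs)
  · intro hP X Y p hp f
    obtain ⟨g, hg⟩ := Module.projective_lifting_property p.hom.hom f.hom.hom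
      ((modExactStructure_deflation_iff p).1 hp)
    exact ⟨FGModuleCat.ofHom g, FGModuleCat.hom_ext hg⟩

/-- Reduces orthogonality to all projectives to the single test object `Γ`. -/
theorem modExactStructure_leftOrthogonal_iff (X : FGModuleCat.{u} Γ) :
    (modExactStructure Γ).projectives.leftOrthogonal X ↔ Subsingleton (X →ₗ[Γ] Γ) := by
  constructor
  · intro hX
    refine subsingleton_of_forall_eq 0 fun f => ?_
    exact congrArg (fun f : X ⟶ FGModuleCat.of Γ Γ => f.hom.hom) (hX (FGModuleCat.ofHom f)
      ((modExactStructure_projectives_iff _).2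
        (inferInstanceAs (Module.Projective Γ Γ))))
  · intro hX P f hP
    have := (modExactStructure_projectives_iff P).1 hP
    have := Module.Projective.subsingleton_hom (P := P) hX
    exact FGModuleCat.hom_ext (Subsingleton.elim f.hom.hom 0)

end ModExactStructure

/-! ### Vanishing of Ext¹ from splittings -/

section

attribute [local instance] Abelian.hasFiniteBiproducts

/-- The Yoneda extension group vanishes as soon as all conflations split. -/
theorem ExactStructure.subsingleton_ext1 {C : Type u} [Category.{v} C] [Abelian C] {A B : C}
    (h : ∀ s : (ExactStructure.ofAbelian C).Extension A B, ∃ r, s.incl ≫ r = 𝟙 B) :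
    Subsingleton ((ExactStructure.ofAbelian C).Ext1 A B) := by
  refine ⟨fun a b => ?_⟩
  induction a using Quotient.inductionOn with | _ s
  induction b using Quotient.inductionOn with | _ t
  obtain ⟨r, hr⟩ := h s
  obtain ⟨r', hr'⟩ := h t
  have hs : (ShortComplex.mk s.incl s.proj s.zero).ShortExact := s.conflation
  have ht : (ShortComplex.mk t.incl t.proj t.zero).ShortExact := t.conflation
  have := ht.epi_g
  let σ := ShortComplex.Splitting.ofExactOfRetraction _ ht.exact r' hr' ht.epi_g
  have hσ : σ.s ≫ t.proj = 𝟙 A := σ.s_g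
  -- Both middle terms are `B ⊕ A`: the retraction of `s` reads off the components and the section
  -- of `t` reassembles them.
  let e : s.mid ⟶ t.mid := r ≫ t.incl + s.proj ≫ σ.s
  have h₁ : s.incl ≫ e = t.incl := by
    rw [Preadditive.comp_add, reassoc_of% hr, reassoc_of% s.zero, zero_comp, add_zero]
  have h₂ : e ≫ t.proj = s.proj := by
    rw [Preadditive.add_comp, Category.assoc, Category.assoc, t.zero, hσ, comp_zero, zero_add,
      Category.comp_id]
  let φ : ShortComplex.mk s.incl s.proj s.zero ⟶ ShortComplex.mk t.incl t.proj t.zero :=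
    { τ₁ := 𝟙 B
      τ₂ := e
      τ₃ := 𝟙 A
      comm₁₂ := by simp [h₁]
      comm₂₃ := by simp [h₂] }
  have : IsIso φ.τ₁ := inferInstanceAs (IsIso (𝟙 B))
  have : IsIso φ.τ₃ := inferInstanceAs (IsIso (𝟙 A))
  have : IsIso e := ShortComplex.isIso₂_of_shortExact_of_isIso₁₃ φ hs ht
  exact Quotient.sound ⟨asIso e, h₁, h₂⟩

end

/-! ### The two implications -/

section MainDirections

variable {Γ : Type u} [Ring Γ] [IsNoetherianRing Γ]

/-- The torsion part of `X` is the common kernel of its linear forms. The module `I` governs the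
torsion pair and A2; projectivity of `J` enters only in the Ext-vanishing. -/
theorem isMoritaTachikawa_of_exact [IsArtinianRing Γ] {I J : Type u} [AddCommGroup I] [Module Γ I]
    [Module.Injective Γ I] [Module.Projective Γ I] [AddCommGroup J] [Module Γ J]
    [Module.Projective Γ J] (ι : Γ →ₗ[Γ] I) (hι : Function.Injective ι) (d : I →ₗ[Γ] J)
    (hd : LinearMap.range ι = LinearMap.ker d) : (modExactStructure Γ).IsMoritaTachikawa where
  enough_projectives X := by
    obtain ⟨P, p, hP, hp⟩ := exists_free_surjective Γ X
    exact ⟨P, p, (modExactStructure_projectives_iff P).2 hP,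
      (modExactStructure_deflation_iff p).2 hp⟩
  torsion_pair := by
    refine ⟨?_, fun X => ?_⟩
    · rintro T F hT ⟨P, i, hP, hi⟩ f
      refine FGModuleCat.hom_ext (LinearMap.ext fun x =>
        (modExactStructure_inflation_iff i).1 hi ?_)
      have h : f ≫ i = 0 := hT _ hP
      have hx : i.hom.hom (f.hom.hom x) = 0 :=
        LinearMap.congr_fun (congrArg (fun f : T ⟶ P => f.hom.hom) h) x
      exact hx.trans (map_zero i.hom.hom).symm
    · obtain ⟨P, _, _, g, hP, hP', hg⟩ := exists_projective_forall_ker_le Γ X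
      have hgr : Function.Exact (LinearMap.ker g).subtype g.rangeRestrict := by
        rw [LinearMap.exact_iff, LinearMap.ker_rangeRestrict, Submodule.range_subtype]
      refine ⟨FGModuleCat.of Γ (LinearMap.ker g), FGModuleCat.of Γ (LinearMap.range g),
        FGModuleCat.ofHom (LinearMap.ker g).subtype, FGModuleCat.ofHom g.rangeRestrict,
        FGModuleCat.hom_ext (LinearMap.ext fun x => hgr.apply_apply_eq_zero x), ?_, ?_, ?_⟩
      · exact (modExactStructure_leftOrthogonal_iff _).2 <|
          subsingleton_hom_of_forall_comp_eq_zero ι hι (LinearMap.ker g).subtype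
            (LinearMap.ker g).subtype_injective fun f => LinearMap.ext fun x => hg f x.2
      · exact ⟨FGModuleCat.of Γ P, FGModuleCat.ofHom (LinearMap.range g).subtype,
          (modExactStructure_projectives_iff _).2 hP',
          (modExactStructure_inflation_iff _).2 (LinearMap.range g).subtype_injective⟩
      · exact (modExactStructure_conflation_iff _).2 ⟨(LinearMap.ker g).subtype_injective,
          g.surjective_rangeRestrict, hgr⟩
  axiomA2 X T hT f := by
    refine ⟨FGModuleCat.of Γ (LinearMap.range f.hom.hom), FGModuleCat.ofHom f.hom.hom.rangeRestrict,
      FGModuleCat.ofHom (LinearMap.range f.hom.hom).subtype,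
      (modExactStructure_deflation_iff _).2 f.hom.hom.surjective_rangeRestrict,
      (modExactStructure_inflation_iff _).2 (LinearMap.range f.hom.hom).subtype_injective,
      rfl, (modExactStructure_leftOrthogonal_iff _).2 ?_⟩
    have := (modExactStructure_leftOrthogonal_iff T).1 hT
    exact subsingleton_hom_of_forall_comp_eq_zero ι hι (LinearMap.range f.hom.hom).subtype
      (LinearMap.range f.hom.hom).subtype_injective fun g => by
        rw [Subsingleton.elim g 0, LinearMap.zero_comp]
  ext_vanishing X P hX hP := by
    refine ExactStructure.subsingleton_ext1 fun s => ?_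
    obtain ⟨hi, hp, hip⟩ := (modExactStructure_conflation_iff _).1 s.conflation
    have hX := (modExactStructure_leftOrthogonal_iff X).1 hX
    have := (modExactStructure_projectives_iff P).1 hP
    obtain ⟨n, f, hf⟩ := Module.Finite.exists_fin' Γ P
    -- `P` is a summand of `Γⁿ` via `t`; extending the coordinates of `t` to the middle term and
    -- applying `f` gives a retraction.
    obtain ⟨t, ht⟩ := Module.projective_lifting_property f LinearMap.id hf
    choose g hg using fun k : Fin n => exists_extension_linearForm ι hι d hd s.incl.hom.hom hi
      s.proj.hom.hom hp hip hX (LinearMap.proj k ∘ₗ t)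
    refine ⟨FGModuleCat.ofHom (f ∘ₗ LinearMap.pi g), FGModuleCat.hom_ext (LinearMap.ext fun x => ?_)⟩
    have h : LinearMap.pi g (s.incl.hom.hom x) = t x :=
      funext fun k => LinearMap.congr_fun (hg k) x
    change f (LinearMap.pi g (s.incl.hom.hom x)) = x
    rw [h]
    exact LinearMap.congr_fun ht x

/-- A2 factors the inclusion of `N` through a torsion object by a deflation; that deflation is also
injective, so `N` is isomorphic to the torsion object. -/
theorem ExactStructure.IsMoritaTachikawa.subsingleton_hom_submodule
    (h : (modExactStructure Γ).IsMoritaTachikawa) (X : Type u) [AddCommGroup X]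
    [Module Γ X] [Module.Finite Γ X] (hX : Subsingleton (X →ₗ[Γ] Γ)) (N : Submodule Γ X) :
    Subsingleton (N →ₗ[Γ] Γ) := by
  obtain ⟨I, p, i, hp, hi, hpi, hI⟩ := h.axiomA2 (X := FGModuleCat.of Γ N)
    ((modExactStructure_leftOrthogonal_iff (FGModuleCat.of Γ X)).2 hX)
    (FGModuleCat.ofHom N.subtype)
  have hI := (modExactStructure_leftOrthogonal_iff I).1 hI
  have hpi : i.hom.hom ∘ₗ p.hom.hom = N.subtype :=
    congrArg (fun f : FGModuleCat.of Γ N ⟶ FGModuleCat.of Γ X => f.hom.hom) hpi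
  have hpinj : Function.Injective p.hom.hom := by
    have := N.subtype_injective
    rw [← hpi, LinearMap.coe_comp] at this
    exact this.of_comp
  let e : N ≃ₗ[Γ] I := LinearEquiv.ofBijective p.hom.hom
    ⟨hpinj, (modExactStructure_deflation_iff p).1 hp⟩
  exact (e.congrLeft Γ ℕ).toEquiv.subsingleton

/-- The map is `X → F → P`, from the torsion-free quotient and its inflation into a projective; its
kernel is the torsion part of `X`. -/
theorem ExactStructure.IsMoritaTachikawa.exists_map_projective
    (h : (modExactStructure Γ).IsMoritaTachikawa) (X : Type u) [AddCommGroup X]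
    [Module Γ X] [Module.Finite Γ X] : ∃ (P : FGModuleCat.{u} Γ) (g : X →ₗ[Γ] P),
      Module.Projective Γ P ∧ Subsingleton (LinearMap.ker g →ₗ[Γ] Γ) := by
  obtain ⟨T, F, i, p, hip, hT, ⟨P, j, hP, hj⟩, hconf⟩ := h.torsion_pair.2 (FGModuleCat.of Γ X)
  obtain ⟨hi, hp, hex⟩ := (modExactStructure_conflation_iff _).1 hconf
  have hT := (modExactStructure_leftOrthogonal_iff T).1 hT
  have hj := (modExactStructure_inflation_iff j).1 hj
  refine ⟨P, j.hom.hom ∘ₗ p.hom.hom, (modExactStructure_projectives_iff P).1 hP, ?_⟩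
  have hker : LinearMap.range i.hom.hom = LinearMap.ker (j.hom.hom ∘ₗ p.hom.hom) := by
    rw [LinearMap.ker_comp_of_ker_eq_bot _ (LinearMap.ker_eq_bot.2 hj)]
    exact hex.linearMap_ker_eq.symm
  let e := (LinearEquiv.ofInjective i.hom.hom hi).trans (LinearEquiv.ofEq _ _ hker)
  exact (e.congrLeft Γ ℕ).symm.toEquiv.subsingleton

/-- Ext¹ is only a set of classes, so the extension is compared with the split one on `Γ × X`, whose
section is transported along the equivalence. -/
theorem ExactStructure.IsMoritaTachikawa.exists_retraction
    (h : (modExactStructure Γ).IsMoritaTachikawa) {E X : Type u} [AddCommGroup E]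
    [Module Γ E] [Module.Finite Γ E] [AddCommGroup X] [Module Γ X] [Module.Finite Γ X]
    (hX : Subsingleton (X →ₗ[Γ] Γ)) (i : Γ →ₗ[Γ] E) (hi : Function.Injective i) (p : E →ₗ[Γ] X)
    (hp : Function.Surjective p) (hip : Function.Exact i p) :
    ∃ s : X →ₗ[Γ] E, p ∘ₗ s = LinearMap.id := by
  have := h.ext_vanishing ((modExactStructure_leftOrthogonal_iff (FGModuleCat.of Γ X)).2 hX)
    ((modExactStructure_projectives_iff (FGModuleCat.of Γ Γ)).2
      (inferInstanceAs (Module.Projective Γ Γ)))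
  let s : (modExactStructure Γ).Extension (FGModuleCat.of Γ X) (FGModuleCat.of Γ Γ) :=
    { mid := FGModuleCat.of Γ E
      incl := FGModuleCat.ofHom i
      proj := FGModuleCat.ofHom p
      zero := FGModuleCat.hom_ext (LinearMap.ext fun x => hip.apply_apply_eq_zero x)
      conflation := (modExactStructure_conflation_iff _).2 ⟨hi, hp, hip⟩ }
  let t : (modExactStructure Γ).Extension (FGModuleCat.of Γ X) (FGModuleCat.of Γ Γ) :=
    { mid := FGModuleCat.of Γ (Γ × X)
      incl := FGModuleCat.ofHom (LinearMap.inl Γ Γ X)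
      proj := FGModuleCat.ofHom (LinearMap.snd Γ Γ X)
      zero := FGModuleCat.hom_ext (LinearMap.ext fun x => rfl)
      conflation := (modExactStructure_conflation_iff _).2
        ⟨LinearMap.inl_injective, LinearMap.snd_surjective, Function.Exact.inl_snd⟩ }
  obtain ⟨e, -, he⟩ := Quotient.exact (this.elim (Quotient.mk _ t) (Quotient.mk _ s))
  have he : p ∘ₗ e.hom.hom.hom = LinearMap.snd Γ Γ X :=
    congrArg (fun f : FGModuleCat.of Γ (Γ × X) ⟶ FGModuleCat.of Γ X => f.hom.hom) he
  exact ⟨e.hom.hom.hom ∘ₗ LinearMap.inr Γ Γ X, by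
    rw [← LinearMap.comp_assoc, he, LinearMap.snd_comp_inr]⟩

end MainDirections

/-- Each `n` in the supremum may come with its own resolution, but a single `n ≥ 2` supplies both
projective terms, so uniqueness of minimal resolutions is not needed. -/
theorem two_le_dominantDimension_iff (Γ : Type u) [Ring Γ] : 2 ≤ dominantDimension Γ ↔
    ∃ I : InjectiveResolution (ModuleCat.of Γ Γ), IsMinimalInjectiveResolution I ∧
      Module.Projective Γ (I.cocomplex.X 0) ∧ Module.Projective Γ (I.cocomplex.X 1) := by
  constructor
  · intro h
    by_contra hI
    have hle : dominantDimension Γ ≤ 1 := iSup₂_le fun n ⟨I, hmin, hproj⟩ => by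
      by_contra hn
      have hn : 1 < n := by exact_mod_cast not_le.1 hn
      exact hI ⟨I, hmin, hproj 0 (by omega), hproj 1 hn⟩
    exact absurd (h.trans hle) (by decide)
  · rintro ⟨I, hmin, h0, h1⟩
    refine le_iSup₂_of_le (f := fun (n : ℕ) (_ : ∃ I : InjectiveResolution (ModuleCat.of Γ Γ),
      IsMinimalInjectiveResolution I ∧ ∀ i < n, Module.Projective Γ (I.cocomplex.X i)) => (n : ℕ∞))
      2 ⟨I, hmin, fun i hi => ?_⟩ le_rfl
    interval_cases i
    · exact h0
    · exact h1

/-- Over an Artin algebra `Γ` such that `mod Γ` is a Morita-Tachikawa category, injective hulls of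
torsion-free modules are projective. -/
theorem ExactStructure.IsMoritaTachikawa.projective_of_isEssentialSubmodule (R : Type w)
    [CommRing R] [IsArtinianRing R] {Γ : Type u} [Ring Γ] [Algebra R Γ] [Module.Finite R Γ]
    [IsNoetherianRing Γ] (h : (modExactStructure Γ).IsMoritaTachikawa) {I : Type u}
    [AddCommGroup I] [Module Γ I] [Module.Injective Γ I] {K : Submodule Γ I} [Module.Finite Γ K]
    (hK : IsEssentialSubmodule K) (hKtors : ∀ N ≤ K, Subsingleton (N →ₗ[Γ] Γ) → N = ⊥) :
    Module.Finite Γ I ∧ Module.Projective Γ I := by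
  have := hK.finite R
  obtain ⟨P, g, hP, hg⟩ := h.exists_map_projective I
  exact ⟨this, Module.Projective.of_injective_map g
    (injective_of_isEssentialSubmodule (fun X _ _ _ hX N => h.subsingleton_hom_submodule X hX N)
      hK hKtors g hg)⟩

/-- If `0 ⟶ Γ ⟶ I ⟶ J` is exact with `I` finitely generated projective, then `Ext`-vanishing forces
the cokernel of `Γ ⟶ I` to be torsion-free. -/
theorem ExactStructure.IsMoritaTachikawa.eq_bot_of_le_range {Γ : Type u} [Ring Γ]
    [IsNoetherianRing Γ] (h : (modExactStructure Γ).IsMoritaTachikawa) {I J : Type u}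
    [AddCommGroup I] [Module Γ I] [Module.Finite Γ I] [Module.Projective Γ I] [AddCommGroup J]
    [Module Γ J] (ι : Γ →ₗ[Γ] I) (hι : Function.Injective ι) (d : I →ₗ[Γ] J)
    (hd : LinearMap.range ι = LinearMap.ker d) (N : Submodule Γ J) (hN : N ≤ LinearMap.range d)
    (hNtors : Subsingleton (N →ₗ[Γ] Γ)) : N = ⊥ := by
  -- The extension to split is `0 → Γ → d⁻¹(N) → N → 0`.
  have hιN (x : Γ) : ι x ∈ N.comap d := by
    have : ι x ∈ LinearMap.ker d := hd ▸ LinearMap.mem_range_self ι x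
    rw [Submodule.mem_comap, LinearMap.mem_ker.1 this]
    exact N.zero_mem
  let i : Γ →ₗ[Γ] N.comap d := ι.codRestrict _ hιN
  let p : N.comap d →ₗ[Γ] N := d.restrict fun x hx => hx
  have hp : Function.Surjective p := by
    rintro ⟨y, hy⟩
    obtain ⟨x, rfl⟩ := hN hy
    exact ⟨⟨x, hy⟩, rfl⟩
  have hip : Function.Exact i p := by
    intro x
    have : p x = 0 ↔ x.1 ∈ LinearMap.ker d := Subtype.ext_iff
    rw [this, ← hd]
    exact ⟨fun ⟨y, hy⟩ => ⟨y, Subtype.ext hy⟩, fun ⟨y, hy⟩ => ⟨y, congrArg Subtype.val hy⟩⟩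
  have : Module.Finite Γ N := Module.Finite.of_surjective p hp
  obtain ⟨s, hs⟩ := h.exists_retraction hNtors i (fun x y hxy => hι (congrArg Subtype.val hxy)) p hp
    hip
  -- The section, viewed in the projective `I`, is a map out of a torsion module; as it vanishes, so
  -- does the identity of `N`.
  have hs0 : (N.comap d).subtype ∘ₗ s = 0 :=
    (Module.Projective.subsingleton_hom (P := I) hNtors).elim _ _
  rw [eq_bot_iff]
  intro y hy
  have h1 : p (s ⟨y, hy⟩) = ⟨y, hy⟩ := LinearMap.congr_fun hs _
  have h2 : s ⟨y, hy⟩ = 0 := Subtype.ext (LinearMap.congr_fun hs0 ⟨y, hy⟩)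
  rw [h2, map_zero] at h1
  exact (congrArg Subtype.val h1).symm

theorem mainTheorem7 (R : Type w) [CommRing R] [IsArtinianRing R]
    (Γ : Type u) [Ring Γ] [Algebra R Γ] [Module.Finite R Γ] :
    haveI : IsNoetherianRing Γ := IsNoetherianRing.of_finite R Γ
    2 ≤ dominantDimension Γ ↔ (modExactStructure Γ).IsMoritaTachikawa := by
  have : IsNoetherianRing Γ := IsNoetherianRing.of_finite R Γ
  have : IsArtinianRing Γ := IsArtinianRing.of_finite R Γ
  rw [two_le_dominantDimension_iff]
  constructor
  · rintro ⟨I, -, h0, h1⟩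
    obtain ⟨ι, hι, hd⟩ := I.exists_augmentation
    have := I.injective_module 0
    exact isMoritaTachikawa_of_exact ι hι _ hd
  · intro h
    let I := (ModuleCat.of Γ Γ).minimalInjectiveResolution
    have hI : IsMinimalInjectiveResolution I :=
      (ModuleCat.of Γ Γ).isMinimal_minimalInjectiveResolution
    obtain ⟨ι, hι, hd⟩ : ∃ ι : Γ →ₗ[Γ] I.cocomplex.X 0, Function.Injective ι ∧
      LinearMap.range ι = LinearMap.ker (I.cocomplex.d 0 1).hom := I.exists_augmentation
    have := I.injective_module 0
    have := I.injective_module 1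
    obtain ⟨_, h0⟩ : Module.Finite Γ (I.cocomplex.X 0) ∧ Module.Projective Γ (I.cocomplex.X 0) := by
      have : Module.Finite Γ (LinearMap.ker (I.cocomplex.d 0 1).hom) :=
        hd ▸ Module.Finite.range ι
      refine h.projective_of_isEssentialSubmodule R (hI 0) fun N hN hNtors => ?_
      let e := LinearEquiv.ofInjective ι hι
      -- Since `ker d⁰ ≅ Γ`, the inclusion of `N` is itself a linear form.
      let f : N →ₗ[Γ] Γ := e.symm.toLinearMap ∘ₗ Submodule.inclusion (hN.trans hd.ge)
      rw [eq_bot_iff]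
      intro x hx
      have h1 : e.symm (Submodule.inclusion (hN.trans hd.ge) ⟨x, hx⟩) = 0 :=
        LinearMap.congr_fun (hNtors.elim f 0) ⟨x, hx⟩
      rw [LinearEquiv.symm_apply_eq, map_zero] at h1
      exact congrArg Subtype.val h1
    obtain ⟨-, h1⟩ : Module.Finite Γ (I.cocomplex.X 1) ∧ Module.Projective Γ (I.cocomplex.X 1) := by
      -- Finite generation and projectivity of `I⁰`, just obtained, are what make `ker d¹` finitely
      -- generated and free of torsion submodules.
      have hr := I.range_d_eq_ker_d 0
      have : Module.Finite Γ (LinearMap.ker (I.cocomplex.d 1 2).hom) :=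
        hr ▸ Module.Finite.range (I.cocomplex.d 0 1).hom
      exact h.projective_of_isEssentialSubmodule R (hI 1) fun N hN hNtors =>
        h.eq_bot_of_le_range ι hι _ hd N (hN.trans hr.ge) hNtors
    exact ⟨I, hI, h0, h1⟩
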